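/- **Setting.** Let $A\in\mathbb{R}^{m\times d}$ have full row rank and let $\mathcal X=\{x\in\mathbb{R}^d: Ax=b,\ x\ge 0\}$ be nonempty, bounded and nondegenerate (every extreme point has exactly $m$ strictly positive components). Let $\mathcal C\subseteq\mathbb{R}^d$ be convex and let $P_c$ be a probability distribution supported on $\mathcal C$. Write $\mathcal X^\star(c)=\arg\min_{x\in\mathcal X}c^\top x$; let $\mathcal X^\star(\mathcal C)$ be the set of extreme points of $\mathcal X$ that are optimal for some $c\in\mathcal C$, and $d^\star=\dim\operatorname{span}\{x-x':x,x'\in\mathcal X^\star(\mathcal C)\}$. For a finite $\mathcal D\subset\mathbb{R}^d$ the fiber of $c$ is $\mathcal C_{\mathcal D}(c)=\{c'\in\mathcal C: q^\top c'=q^\top c\ \forall q\in\mathcal D\}$; $\mathcal D$ is *pointwise sufficient* at $c$ if some $x\in\mathcal X$ lies in $\mathcal X^\star(c')$ for all $c'\in\mathcal C_{\mathcal D}(c)$. Put $R(\mathcal D)=\Pr_{c\sim P_c}[\mathcal D\text{ is not pointwise sufficient at }c]$. For a basis $B$ with nonbasic set $N$ and $j\in N$ let $\delta_j=\delta(B,j)$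 be the edge direction with $\delta_N=e_j$, $\delta_B=-A_B^{-1}A_j$. **Pointwise algorithm** (input $c\in\mathcal C$ and an initial dataset $\mathcal D$). Repeat: choose an anchor $c^{\rm in}\in\mathcal C_{\mathcal D}(c)$ (for instance $c$) and an optimal basis $B$ for $c^{\rm in}$. If $c'^\top\delta_j\ge0$ for all $j\in N$ and all $c'\in\mathcal C_{\mathcal D}(c)$, return $\mathcal D$. Otherwise choose $c^{\rm out}\in\mathcal C_{\mathcal D}(c)$ with $(c^{\rm out})^\top\delta_{j_0}=\min_{j\in N}\min_{c'\in\mathcal C_{\mathcal D}(c)}c'^\top\delta_j$ for some $j_0\in N$ (if this minimum is not attained, any $c^{\rm out}\in\mathcal C_{\mathcal D}(c)$ with $(c^{\rm out})^\top\delta_j<0$ for some $j\in N$); among the $j\in N$ with $(c^{\rm out})^\top\delta_j<0$ choose $j^\star$ minimizing $\alpha_j=\frac{(c^{\rm in})^\top\delta_j}{(c^{\rm in})^\top\delta_j-(c^{\rm out})^\top\delta_j}$, and add $\delta_{j^\star}$ to $\mathcal D$. All choices are made by a fixed deterministic (measurable) rule depending on the current dataset and on $c$. **Cumulative algorithm**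 (input $c_1,\dots,c_n$). Start with $\mathcal D_0=\varnothing$; for $i=1,\dots,n$ let $\mathcal D_i$ be the output of the pointwise algorithm at $c_i$ initialized at $\mathcal D_{i-1}$. Return $\mathcal D_n$ and the set $T=\{i:\mathcal D_i\ne\mathcal D_{i-1}\}$ of hard indices. **Theorem.** Let $n\ge1$. (a) For all $c_1,\dots,c_n\in\mathcal C$ the cumulative algorithm terminates, and it is a realizable stable compression scheme of size at most $d^\star$: its output $(\mathcal D_n,T)$ is unique, $\mathcal D_n$ is pointwise sufficient at each $c_i$, for every $J$ with $T\subseteq J\subseteq\{1,\dots,n\}$ the run on the subsequence $(c_i)_{i\in J}$ returns the same dataset and the same hard samples, and $|T|\le d^\star$. (b) For every $\delta\in(0,1)$, with probability at least $1-\delta$ over i.i.d. $c_1,\dots,c_n\sim P_c$, $$R(\mathcal D_n)\ \le\ \frac4n\Bigl(6|T|+\ln\frac e\delta\Bigr)\ \le\ \frac4n\Bigl(6d^\star+\ln\frac e\delta\Bigr).$$ -/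

import Mathlib

open MeasureTheory Matrix

namespace DecisionData

/-- The feasible region `{x | A x = b, x ≥ 0}`. -/
def polytope {m d : ℕ} (A : Matrix (Fin m) (Fin d) ℝ) (b : Fin m → ℝ) : Set (Fin d → ℝ) :=
  {x | A *ᵥ x = b ∧ ∀ i, 0 ≤ x i}

/-- The set of minimizers of the linear cost `c` over `X`. -/
def optimalSet {d : ℕ} (X : Set (Fin d → ℝ)) (c : Fin d → ℝ) : Set (Fin d → ℝ) :=
  {x | x ∈ X ∧ ∀ y ∈ X, c ⬝ᵥ x ≤ c ⬝ᵥ y}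

/-- The extreme points of `X` that are optimal for some cost in `C`. -/
def reachableOptima {d : ℕ} (X C : Set (Fin d → ℝ)) : Set (Fin d → ℝ) :=
  ⋃ c ∈ C, optimalSet X c ∩ X.extremePoints ℝ

/-- The decision-relevant subspace: the span of all differences of reachable optima. -/
def relevantSubspace {d : ℕ} (X C : Set (Fin d → ℝ)) : Submodule ℝ (Fin d → ℝ) :=
  Submodule.span ℝ {v | ∃ x ∈ reachableOptima X C, ∃ y ∈ reachableOptima X C, v = x - y}

/-- The intrinsic decision-relevant dimension. -/
noncomputable def intrinsicDim {d : ℕ} (X C : Set (Fin d → ℝ)) : ℕ :=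
  Module.finrank ℝ (relevantSubspace X C)

/-- Every extreme point has exactly `m` strictly positive components. -/
def Nondegenerate {m d : ℕ} (A : Matrix (Fin m) (Fin d) ℝ) (b : Fin m → ℝ) : Prop :=
  ∀ x ∈ (polytope A b).extremePoints ℝ, {i | 0 < x i}.ncard = m

/-- The costs in `C` that give the same measurements along `D` as `c`. -/
def fiber {d : ℕ} (C : Set (Fin d → ℝ)) (D : Finset (Fin d → ℝ)) (c : Fin d → ℝ) :
    Set (Fin d → ℝ) :=
  {c' | c' ∈ C ∧ ∀ q ∈ D, q ⬝ᵥ c' = q ⬝ᵥ c}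

/-- One decision is optimal for every cost in the fiber of `c`. -/
def PointwiseSufficient {d : ℕ} (X C : Set (Fin d → ℝ)) (D : Finset (Fin d → ℝ))
    (c : Fin d → ℝ) : Prop :=
  ∃ x ∈ X, ∀ c' ∈ fiber C D c, x ∈ optimalSet X c'

/-- The probability that `D` is not pointwise sufficient at a fresh cost drawn from `P`. -/
noncomputable def risk {d : ℕ} (X C : Set (Fin d → ℝ)) (P : Measure (Fin d → ℝ))
    (D : Finset (Fin d → ℝ)) : ℝ :=
  P.real {c | ¬ PointwiseSufficient X C D c}

/-! ### Bases

A choice of `m` of the `d` columns is an order embedding `B : Fin m ↪o Fin d` (these correspond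
exactly to the `m`-element subsets); the nonbasic indices are those outside `Set.range B`. -/

/-- The square matrix `A_B` of the chosen columns. -/
def basisMatrix {m d : ℕ} (A : Matrix (Fin m) (Fin d) ℝ) (B : Fin m ↪o Fin d) :
    Matrix (Fin m) (Fin m) ℝ :=
  A.submatrix id B

/-- The basic solution: `x_B = A_B⁻¹ b` and `x_N = 0`. -/
noncomputable def basicSolution {m d : ℕ} (A : Matrix (Fin m) (Fin d) ℝ) (b : Fin m → ℝ)
    (B : Fin m ↪o Fin d) : Fin d → ℝ :=
  ∑ k, Pi.single (B k) (((basisMatrix A B)⁻¹ *ᵥ b) k)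

/-- For nonbasic `j`, the edge direction: `δ_N = e_j` and `δ_B = - A_B⁻¹ A_j`. -/
noncomputable def edgeDir {m d : ℕ} (A : Matrix (Fin m) (Fin d) ℝ) (B : Fin m ↪o Fin d)
    (j : Fin d) : Fin d → ℝ :=
  Pi.single j 1 - ∑ k, Pi.single (B k) (((basisMatrix A B)⁻¹ *ᵥ (fun i => A i j)) k)

/-- `B` is a basis (`A_B` invertible) whose basic solution is feasible and optimal for `c`. -/
def IsOptimalBasis {m d : ℕ} (A : Matrix (Fin m) (Fin d) ℝ) (b : Fin m → ℝ)
    (c : Fin d → ℝ) (B : Fin m ↪o Fin d) : Prop :=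
  IsUnit (basisMatrix A B).det ∧ basicSolution A b B ∈ optimalSet (polytope A b) c

/-- The cone of costs for which all reduced costs of `B` are nonnegative. -/
def basisCone {m d : ℕ} (A : Matrix (Fin m) (Fin d) ℝ) (B : Fin m ↪o Fin d) :
    Set (Fin d → ℝ) :=
  {c | ∀ j ∉ Set.range B, 0 ≤ c ⬝ᵥ edgeDir A B j}

/-! ### The cutting-plane algorithm at one cost -/

/-- `z` solves the face-intersection problems of `B` over the set `F`: for some nonbasic `j₀`
minimizing `m_j = min_{c' ∈ F} c' ⬝ δ_j` over all nonbasic `j`, it attains `m_{j₀}`. -/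
def IsFaceMinimizer {m d : ℕ} (A : Matrix (Fin m) (Fin d) ℝ) (B : Fin m ↪o Fin d)
    (F : Set (Fin d → ℝ)) (z : Fin d → ℝ) : Prop :=
  z ∈ F ∧ ∃ j₀ ∉ Set.range B, ∀ j ∉ Set.range B, ∀ c' ∈ F,
    z ⬝ᵥ edgeDir A B j₀ ≤ c' ⬝ᵥ edgeDir A B j

/-- An admissible witness that `F` is not contained in the cone of `B`: a point of `F` outside the
cone, which solves the face-intersection problems whenever their overall minimum is attained. -/
def IsOuterPoint {m d : ℕ} (A : Matrix (Fin m) (Fin d) ℝ) (B : Fin m ↪o Fin d)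
    (F : Set (Fin d → ℝ)) (z : Fin d → ℝ) : Prop :=
  z ∈ F ∧ (∃ j ∉ Set.range B, z ⬝ᵥ edgeDir A B j < 0) ∧
    ((∃ w, IsFaceMinimizer A B F w) → IsFaceMinimizer A B F z)

/-- The ratio `α_j` at which the segment from `cin` to `cout` meets the `j`-th facet. -/
noncomputable def hitRatio {m d : ℕ} (A : Matrix (Fin m) (Fin d) ℝ) (B : Fin m ↪o Fin d)
    (cin cout : Fin d → ℝ) (j : Fin d) : ℝ :=
  (cin ⬝ᵥ edgeDir A B j) / (cin ⬝ᵥ edgeDir A B j - cout ⬝ᵥ edgeDir A B j)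

/-- `j` indexes a facet violated by `cout` with the least ratio `α_j`. -/
def IsFirstFacet {m d : ℕ} (A : Matrix (Fin m) (Fin d) ℝ) (B : Fin m ↪o Fin d)
    (cin cout : Fin d → ℝ) (j : Fin d) : Prop :=
  j ∉ Set.range B ∧ cout ⬝ᵥ edgeDir A B j < 0 ∧
    ∀ i ∉ Set.range B, cout ⬝ᵥ edgeDir A B i < 0 →
      hitRatio A B cin cout j ≤ hitRatio A B cin cout i

/-- A deterministic rule for the choices that the algorithm makes in an iteration, as functions of
the current dataset and the cost being processed: the anchor, the optimal basis, the outer point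
and the facet to be queried. -/
structure ChoiceRule (m d : ℕ) where
  anchor : Finset (Fin d → ℝ) → (Fin d → ℝ) → (Fin d → ℝ)
  basis : Finset (Fin d → ℝ) → (Fin d → ℝ) → (Fin m ↪o Fin d)
  outer : Finset (Fin d → ℝ) → (Fin d → ℝ) → (Fin d → ℝ)
  facet : Finset (Fin d → ℝ) → (Fin d → ℝ) → Fin d

/-- The rule always chooses among the options that the algorithm allows. The anchor is any point of
the current fiber (in particular it may be `c` itself). -/
def ChoiceRule.Valid {m d : ℕ} (σ : ChoiceRule m d) (A : Matrix (Fin m) (Fin d) ℝ)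
    (b : Fin m → ℝ) (C : Set (Fin d → ℝ)) : Prop :=
  ∀ (D : Finset (Fin d → ℝ)) (c : Fin d → ℝ), c ∈ C →
    σ.anchor D c ∈ fiber C D c ∧
    IsOptimalBasis A b (σ.anchor D c) (σ.basis D c) ∧
    (¬ fiber C D c ⊆ basisCone A (σ.basis D c) →
      IsOuterPoint A (σ.basis D c) (fiber C D c) (σ.outer D c) ∧
      IsFirstFacet A (σ.basis D c) (σ.anchor D c) (σ.outer D c) (σ.facet D c))

open Classical in
/-- One iteration: `none` if the containment test succeeds, else the new query direction. -/
noncomputable def ChoiceRule.nextQuery {m d : ℕ} (σ : ChoiceRule m d)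
    (A : Matrix (Fin m) (Fin d) ℝ) (C : Set (Fin d → ℝ)) (D : Finset (Fin d → ℝ))
    (c : Fin d → ℝ) : Option (Fin d → ℝ) :=
  if fiber C D c ⊆ basisCone A (σ.basis D c) then none
  else some (edgeDir A (σ.basis D c) (σ.facet D c))

open Classical in
/-- `PointwiseRun σ A C c D D'`: at the cost `c`, started from the dataset `D`, the cutting-plane
algorithm terminates and returns `D'`. -/
inductive PointwiseRun {m d : ℕ} (σ : ChoiceRule m d) (A : Matrix (Fin m) (Fin d) ℝ)
    (C : Set (Fin d → ℝ)) (c : Fin d → ℝ) :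
    Finset (Fin d → ℝ) → Finset (Fin d → ℝ) → Prop
  | contained (D : Finset (Fin d → ℝ)) (h : σ.nextQuery A C D c = none) :
      PointwiseRun σ A C c D D
  | query (D D' : Finset (Fin d → ℝ)) (q : Fin d → ℝ) (h : σ.nextQuery A C D c = some q)
      (hrun : PointwiseRun σ A C c (insert q D) D') : PointwiseRun σ A C c D D'

/-! ### The cumulative algorithm -/

/-- `CumulativeFrom σ A C S D l D' T`: processing the costs `S i` for `i` in the list `l`, in this
order and starting from the dataset `D`, every run terminates, the final dataset is `D'`, and the
set of hard indices (those whose run changed the dataset) is `T`. -/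
inductive CumulativeFrom {m d n : ℕ} (σ : ChoiceRule m d) (A : Matrix (Fin m) (Fin d) ℝ)
    (C : Set (Fin d → ℝ)) (S : Fin n → Fin d → ℝ) :
    Finset (Fin d → ℝ) → List (Fin n) → Finset (Fin d → ℝ) → Finset (Fin n) → Prop
  | nil (D : Finset (Fin d → ℝ)) : CumulativeFrom σ A C S D [] D ∅
  | easy (D D' : Finset (Fin d → ℝ)) (i : Fin n) (l : List (Fin n)) (T : Finset (Fin n))
      (h : PointwiseRun σ A C (S i) D D)
      (hrest : CumulativeFrom σ A C S D l D' T) : CumulativeFrom σ A C S D (i :: l) D' T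
  | hard (D D₁ D' : Finset (Fin d → ℝ)) (i : Fin n) (l : List (Fin n)) (T : Finset (Fin n))
      (h : PointwiseRun σ A C (S i) D D₁) (hne : D₁ ≠ D)
      (hrest : CumulativeFrom σ A C S D₁ l D' T) :
      CumulativeFrom σ A C S D (i :: l) D' (insert i T)

/-- The cumulative algorithm, run from the empty dataset on the subsample `(S i)` with `i ∈ J` in
increasing order of `i`, returns the dataset `D` and the hard set `T`. -/
def CumulativeOutput {m d n : ℕ} (σ : ChoiceRule m d) (A : Matrix (Fin m) (Fin d) ℝ)
    (C : Set (Fin d → ℝ)) (S : Fin n → Fin d → ℝ) (J : Finset (Fin n))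
    (D : Finset (Fin d → ℝ)) (T : Finset (Fin n)) : Prop :=
  CumulativeFrom σ A C S ∅ ((List.finRange n).filter (fun i => i ∈ J)) D T

end DecisionData

namespace DecisionData

variable {m d : ℕ}

/-! ### Basic solutions and edge directions -/

/-! Geometry. Nondegeneracy makes the edge directions at a feasible basis feasible directions, so
such a basis is optimal exactly when its reduced costs are nonnegative. Where the segment from the
anchor to the outer point first leaves the cone of the basis, it passes through a cost of `C` at
which the basis is still optimal and one reduced cost vanishes. The corresponding edge lies in an
optimal face, so the query lies in the relevant subspace (`IsFirstFacet.edgeDir_mem`). The anchor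
and the outer point agree on the span of the dataset but are separated by the query, so the query is
outside that span (`ChoiceRule.Valid.query_notMem_span`). Every query thus raises the rank of a span
confined to dimension d⋆, which bounds the number of hard indices
(`CumulativeFrom.card_add_finrank_le`). An easy index leaves the dataset alone, so it can be
dropped: this is stability.

Probability. If the full run returns (D, T), then for every J ⊇ T the run on J returns (D, T) as
well, and D makes no error on the independent points outside J. If the risk of D is at least ε, this
costs a factor (1 - ε)^(n - |J|). Averaging over the 2^(n - k) sets J ⊇ T, where k = |T|, and using
that for fixed J the outcomes are disjoint, gives the tail 2^k (1 - ε/2)^n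
(`measureReal_stable_compression_le`). The level in the certificate makes this at most δ 2^(-k-1),
which is summed over k. -/

theorem sum_single_apply_basic (B : Fin m ↪o Fin d) (y : Fin m → ℝ) (k : Fin m) :
    (∑ l, Pi.single (B l) (y l) : Fin d → ℝ) (B k) = y k := by
  rw [Finset.sum_apply, Finset.sum_eq_single k]
  · simp
  · intro l _ hl
    exact Pi.single_eq_of_ne (fun h => hl (B.injective h).symm) _
  · simp

theorem sum_single_apply_nonbasic (B : Fin m ↪o Fin d) (y : Fin m → ℝ) {i : Fin d}
    (hi : i ∉ Set.range B) : (∑ l, Pi.single (B l) (y l) : Fin d → ℝ) i = 0 := by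
  rw [Finset.sum_apply]
  exact Finset.sum_eq_zero fun l _ => Pi.single_eq_of_ne (fun h => hi ⟨l, h.symm⟩) _

theorem mulVec_sum_single (A : Matrix (Fin m) (Fin d) ℝ) (B : Fin m ↪o Fin d) (y : Fin m → ℝ) :
    A *ᵥ (∑ k, Pi.single (B k) (y k)) = basisMatrix A B *ᵥ y := by
  rw [Matrix.mulVec_sum, Matrix.mulVec_eq_sum]
  refine Finset.sum_congr rfl fun k _ => ?_
  rw [Matrix.mulVec_single]
  ext i
  simp [basisMatrix]

theorem mulVec_edgeDir {A : Matrix (Fin m) (Fin d) ℝ} {B : Fin m ↪o Fin d}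
    (hB : IsUnit (basisMatrix A B).det) (j : Fin d) : A *ᵥ edgeDir A B j = 0 := by
  rw [edgeDir, Matrix.mulVec_sub, mulVec_sum_single, Matrix.mulVec_mulVec,
    Matrix.mul_nonsing_inv _ hB, Matrix.one_mulVec, sub_eq_zero]
  ext i
  simp

theorem edgeDir_apply_nonbasic (A : Matrix (Fin m) (Fin d) ℝ) (B : Fin m ↪o Fin d) (j : Fin d)
    {i : Fin d} (hi : i ∉ Set.range B) : edgeDir A B j i = if i = j then 1 else 0 := by
  rw [edgeDir, Pi.sub_apply, sum_single_apply_nonbasic B _ hi, sub_zero, Pi.single_apply]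

/-- A vector supported on the basic columns is sent by `A` to `A_B` times its basic part, and `A_B`
is injective. -/
theorem eq_zero_of_mulVec_eq_zero {A : Matrix (Fin m) (Fin d) ℝ} {B : Fin m ↪o Fin d}
    (hB : IsUnit (basisMatrix A B).det) {v : Fin d → ℝ} (hv : A *ᵥ v = 0)
    (h0 : ∀ i ∉ Set.range B, v i = 0) : v = 0 := by
  have hsum : v = ∑ k, Pi.single (B k) (v (B k)) := by
    ext i
    by_cases hi : i ∈ Set.range B
    · obtain ⟨k, rfl⟩ := hi
      rw [sum_single_apply_basic B (fun k => v (B k))]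
    · rw [sum_single_apply_nonbasic B _ hi, h0 i hi]
  have hz : (fun k => v (B k)) = 0 := by
    have h := hv
    rw [hsum, mulVec_sum_single A B (fun k => v (B k))] at h
    have h2 := congrArg (fun w => (basisMatrix A B)⁻¹ *ᵥ w) h
    simpa [Matrix.mulVec_mulVec, Matrix.nonsing_inv_mul _ hB] using h2
  rw [hsum]
  exact Finset.sum_eq_zero fun k _ => by rw [congrFun hz k]; simp

-- Both sides lie in the kernel of `A` and have the same nonbasic coordinates, which determine a
-- kernel vector.
open Classical in
theorem eq_sum_edgeDir {A : Matrix (Fin m) (Fin d) ℝ} {B : Fin m ↪o Fin d}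
    (hB : IsUnit (basisMatrix A B).det) {v : Fin d → ℝ} (hv : A *ᵥ v = 0) :
    v = ∑ j with j ∉ Set.range B, v j • edgeDir A B j := by
  rw [← sub_eq_zero]
  refine eq_zero_of_mulVec_eq_zero hB ?_ fun i hi => ?_
  · rw [Matrix.mulVec_sub, hv, Matrix.mulVec_sum, zero_sub, neg_eq_zero]
    exact Finset.sum_eq_zero fun j _ => by rw [Matrix.mulVec_smul, mulVec_edgeDir hB, smul_zero]
  · rw [Pi.sub_apply, Finset.sum_apply, Finset.sum_eq_single i]
    · simp [edgeDir_apply_nonbasic A B i hi]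
    · intro j _ hj
      simp [edgeDir_apply_nonbasic A B j hi, hj.symm]
    · intro h
      exact (h (by simpa using hi)).elim

theorem basicSolution_apply_nonbasic (A : Matrix (Fin m) (Fin d) ℝ) (b : Fin m → ℝ)
    (B : Fin m ↪o Fin d) {i : Fin d} (hi : i ∉ Set.range B) : basicSolution A b B i = 0 :=
  sum_single_apply_nonbasic B _ hi

/-! ### Optimality of a basis -/

/-- A feasible basis is optimal for every cost in its cone. -/
theorem basicSolution_mem_optimalSet {A : Matrix (Fin m) (Fin d) ℝ} {b : Fin m → ℝ}
    {B : Fin m ↪o Fin d} (hB : IsUnit (basisMatrix A B).det)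
    (hx : basicSolution A b B ∈ polytope A b) {c : Fin d → ℝ} (hc : c ∈ basisCone A B) :
    basicSolution A b B ∈ optimalSet (polytope A b) c := by
  classical
  refine ⟨hx, fun y hy => ?_⟩
  have hv : A *ᵥ (y - basicSolution A b B) = 0 := by
    rw [Matrix.mulVec_sub, hy.1, hx.1, sub_self]
  -- In the expansion of `y - x` the coefficients are the nonbasic coordinates of `y`, hence
  -- nonnegative.
  rw [← sub_nonneg, ← dotProduct_sub, eq_sum_edgeDir hB hv, dotProduct_sum]
  refine Finset.sum_nonneg fun j hj => ?_
  have hj' : j ∉ Set.range B := (Finset.mem_filter.1 hj).2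
  rw [dotProduct_smul, Pi.sub_apply, basicSolution_apply_nonbasic A b B hj', sub_zero]
  exact mul_nonneg (hy.2 j) (hc j hj')

/-- Nonnegative points whose proper convex combination vanishes at the nonbasic coordinates vanish
there themselves. -/
theorem basicSolution_mem_extremePoints {A : Matrix (Fin m) (Fin d) ℝ} {b : Fin m → ℝ}
    {B : Fin m ↪o Fin d} (hB : IsUnit (basisMatrix A B).det)
    (hx : basicSolution A b B ∈ polytope A b) :
    basicSolution A b B ∈ (polytope A b).extremePoints ℝ := by
  refine ⟨hx, fun y hy z hz hyz => ?_⟩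
  obtain ⟨s, t, hs, ht, -, hst⟩ := hyz
  rw [← sub_eq_zero]
  refine eq_zero_of_mulVec_eq_zero hB (by rw [Matrix.mulVec_sub, hy.1, hx.1, sub_self])
    fun i hi => ?_
  have h := congrFun hst i
  rw [basicSolution_apply_nonbasic A b B hi] at h
  simp only [Pi.add_apply, Pi.smul_apply, smul_eq_mul] at h
  have h1 := mul_nonneg ht.le (hz.2 i)
  have h2 := mul_nonneg hs.le (hy.2 i)
  have h3 : s * y i = 0 := by linarith
  rw [Pi.sub_apply, basicSolution_apply_nonbasic A b B hi, sub_zero]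
  exact (mul_eq_zero.1 h3).resolve_left hs.ne'

/-- The positive support is contained in the `m` basic indices and has `m` elements by
nondegeneracy, so it is all of them. -/
theorem basicSolution_apply_pos {A : Matrix (Fin m) (Fin d) ℝ} {b : Fin m → ℝ}
    (hnd : Nondegenerate A b) {B : Fin m ↪o Fin d} (hB : IsUnit (basisMatrix A B).det)
    (hx : basicSolution A b B ∈ polytope A b) (k : Fin m) : 0 < basicSolution A b B (B k) := by
  have hsub : {i | 0 < basicSolution A b B i} ⊆ Set.range B := by
    intro i hi
    by_contra h
    exact hi.ne' (basicSolution_apply_nonbasic A b B h)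
  have hcard : (Set.range B).ncard = m := by
    rw [← Set.image_univ, Set.ncard_image_of_injective _ B.injective]
    simp [Set.ncard_univ]
  have heq := Set.eq_of_subset_of_ncard_le hsub
    (by rw [hcard, hnd _ (basicSolution_mem_extremePoints hB hx)]) (Set.toFinite _)
  have hk : B k ∈ {i | 0 < basicSolution A b B i} := heq ▸ Set.mem_range_self k
  exact hk

/-- Under nondegeneracy the edge directions at a feasible basis are feasible directions. -/
theorem exists_pos_add_smul_edgeDir_mem {A : Matrix (Fin m) (Fin d) ℝ} {b : Fin m → ℝ}
    (hnd : Nondegenerate A b) {B : Fin m ↪o Fin d} (hB : IsUnit (basisMatrix A B).det)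
    (hx : basicSolution A b B ∈ polytope A b) (j : Fin d) :
    ∃ s : ℝ, 0 < s ∧ basicSolution A b B + s • edgeDir A B j ∈ polytope A b := by
  -- Basic coordinates start strictly positive and stay so for small `s`; nonbasic ones start at
  -- zero and cannot decrease.
  have hev : ∀ i, ∀ᶠ s : ℝ in nhdsWithin 0 (Set.Ioi 0),
      0 ≤ (basicSolution A b B + s • edgeDir A B j) i := by
    intro i
    by_cases hi : i ∈ Set.range B
    · obtain ⟨k, rfl⟩ := hi
      have hcont : Continuous fun s : ℝ => (basicSolution A b B + s • edgeDir A B j) (B k) := by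
        simp only [Pi.add_apply, Pi.smul_apply, smul_eq_mul]
        fun_prop
      have h0 := (hcont.tendsto 0).eventually (lt_mem_nhds (a := (0 : ℝ))
        (by simpa using basicSolution_apply_pos hnd hB hx k))
      exact nhdsWithin_le_nhds (h0.mono fun s hs => hs.le)
    · filter_upwards [self_mem_nhdsWithin] with s hs
      have hs' : (0 : ℝ) < s := hs
      rw [Pi.add_apply, Pi.smul_apply, basicSolution_apply_nonbasic A b B hi,
        edgeDir_apply_nonbasic A B j hi]
      split_ifs <;> simp [hs'.le]
  obtain ⟨s, hs, hpos⟩ := ((Filter.eventually_all.2 hev).and self_mem_nhdsWithin).exists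
  refine ⟨s, hpos, ?_, hs⟩
  rw [Matrix.mulVec_add, Matrix.mulVec_smul, mulVec_edgeDir hB, smul_zero, add_zero, hx.1]

/-- A negative reduced cost would make a short feasible step along that edge an improvement. Without
nondegeneracy the step might have length zero. -/
theorem IsOptimalBasis.mem_basisCone {A : Matrix (Fin m) (Fin d) ℝ} {b : Fin m → ℝ}
    (hnd : Nondegenerate A b) {B : Fin m ↪o Fin d} {c : Fin d → ℝ} (h : IsOptimalBasis A b c B) :
    c ∈ basisCone A B := by
  intro j _
  obtain ⟨s, hs, hmem⟩ := exists_pos_add_smul_edgeDir_mem hnd h.1 h.2.1 j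
  have hle := h.2.2 _ hmem
  rw [dotProduct_add, dotProduct_smul, smul_eq_mul] at hle
  exact nonneg_of_mul_nonneg_right (by linarith) hs

/-! ### Optimal faces -/

theorem isCompact_polytope {A : Matrix (Fin m) (Fin d) ℝ} {b : Fin m → ℝ}
    (hbdd : Bornology.IsBounded (polytope A b)) : IsCompact (polytope A b) := by
  refine Metric.isCompact_of_isClosed_isBounded ?_ hbdd
  have heq : polytope A b = {x | A *ᵥ x = b} ∩ ⋂ i, {x | 0 ≤ x i} := by
    ext x
    simp [polytope]
  rw [heq]
  exact (isClosed_eq (by fun_prop) continuous_const).inter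
    (isClosed_iInter fun i => isClosed_le continuous_const (continuous_apply i))

theorem convex_polytope (A : Matrix (Fin m) (Fin d) ℝ) (b : Fin m → ℝ) :
    Convex ℝ (polytope A b) := by
  intro x hx y hy s t hs ht hst
  refine ⟨?_, fun i => ?_⟩
  · rw [Matrix.mulVec_add, Matrix.mulVec_smul, Matrix.mulVec_smul, hx.1, hy.1, ← add_smul, hst,
      one_smul]
  · exact add_nonneg (mul_nonneg hs (hx.2 i)) (mul_nonneg ht (hy.2 i))

theorem isExposed_optimalSet (X : Set (Fin d → ℝ)) (c : Fin d → ℝ) :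
    IsExposed ℝ X (optimalSet X c) := by
  intro _
  -- Exposed faces are sets of maximizers, hence the sign.
  refine ⟨-(LinearMap.toContinuousLinearMap (dotProductBilin ℝ ℝ c)), ?_⟩
  ext x
  simp [optimalSet]

/-- The optimal face of a cost in `C` lies in a translate of the relevant subspace. -/
theorem sub_mem_relevantSubspace {X C : Set (Fin d → ℝ)} (hX : IsCompact X) (hconv : Convex ℝ X)
    {c : Fin d → ℝ} (hc : c ∈ C) {x y : Fin d → ℝ} (hx : x ∈ optimalSet X c)
    (hxe : x ∈ X.extremePoints ℝ) (hy : y ∈ optimalSet X c) : y - x ∈ relevantSubspace X C := by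
  have hexp := isExposed_optimalSet X c
  -- Krein–Milman reduces the claim to the extreme points of the optimal face; these are extreme in
  -- `X`, hence reachable optima.
  have hKM := closure_convexHull_extremePoints (hexp.isCompact hX) (hexp.convex hconv)
  have hV : Convex ℝ {z : Fin d → ℝ | z - x ∈ relevantSubspace X C} := by
    intro z hz w hw s t _ _ hst
    have heq : s • z + t • w - x = s • (z - x) + t • (w - x) := by
      rw [smul_sub, smul_sub, sub_add_sub_comm, ← add_smul, hst, one_smul]
    rw [Set.mem_ofPred_eq, heq]
    exact add_mem (Submodule.smul_mem _ s hz) (Submodule.smul_mem _ t hw)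
  have hVc : IsClosed {z : Fin d → ℝ | z - x ∈ relevantSubspace X C} :=
    (Submodule.closed_of_finiteDimensional (relevantSubspace X C)).preimage
      (continuous_id.sub continuous_const)
  have hsub : (optimalSet X c).extremePoints ℝ ⊆ {z | z - x ∈ relevantSubspace X C} := by
    intro z hz
    refine Submodule.subset_span ⟨z, ?_, x, ?_, rfl⟩
    · exact Set.mem_biUnion hc ⟨hz.1, hexp.isExtreme.extremePoints_subset_extremePoints hz⟩
    · exact Set.mem_biUnion hc ⟨hx, hxe⟩
  exact closure_minimal (convexHull_min hsub hV) hVc (hKM.symm ▸ hy)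

/-- An edge direction of zero reduced cost at an optimal basis is decision-relevant. -/
theorem edgeDir_mem_relevantSubspace {A : Matrix (Fin m) (Fin d) ℝ} {b : Fin m → ℝ}
    (hbdd : Bornology.IsBounded (polytope A b)) (hnd : Nondegenerate A b)
    {C : Set (Fin d → ℝ)} {c : Fin d → ℝ} (hc : c ∈ C) {B : Fin m ↪o Fin d}
    (h : IsOptimalBasis A b c B) {j : Fin d} (hj : c ⬝ᵥ edgeDir A B j = 0) :
    edgeDir A B j ∈ relevantSubspace (polytope A b) C := by
  obtain ⟨s, hs, hmem⟩ := exists_pos_add_smul_edgeDir_mem hnd h.1 h.2.1 j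
  have hopt : basicSolution A b B + s • edgeDir A B j ∈ optimalSet (polytope A b) c :=
    ⟨hmem, fun y hy => by simpa [dotProduct_add, hj] using h.2.2 y hy⟩
  have := sub_mem_relevantSubspace (isCompact_polytope hbdd) (convex_polytope A b) hc h.2
    (basicSolution_mem_extremePoints h.1 h.2.1) hopt
  rwa [add_sub_cancel_left, Submodule.smul_mem_iff _ hs.ne'] at this

/-- The first facet that the segment from the anchor to the outer point crosses gives a
decision-relevant direction. -/
theorem IsFirstFacet.edgeDir_mem {A : Matrix (Fin m) (Fin d) ℝ} {b : Fin m → ℝ}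
    (hbdd : Bornology.IsBounded (polytope A b)) (hnd : Nondegenerate A b)
    {C : Set (Fin d → ℝ)} (hC : Convex ℝ C) {B : Fin m ↪o Fin d} {cin cout : Fin d → ℝ}
    (hin : cin ∈ C) (hout : cout ∈ C) (hB : IsOptimalBasis A b cin B) {j : Fin d}
    (hj : IsFirstFacet A B cin cout j) :
    edgeDir A B j ∈ relevantSubspace (polytope A b) C := by
  obtain ⟨hjB, hneg, hmin⟩ := hj
  have hcone := hB.mem_basisCone hnd
  set α := hitRatio A B cin cout j with hα
  have ha := hcone j hjB
  have hα0 : 0 ≤ α := div_nonneg ha (by linarith)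
  have hα1 : α ≤ 1 := div_le_one_of_le₀ (by linarith) (by linarith)
  have key : ∀ i, ((1 - α) • cin + α • cout) ⬝ᵥ edgeDir A B i =
      cin ⬝ᵥ edgeDir A B i - α * (cin ⬝ᵥ edgeDir A B i - cout ⬝ᵥ edgeDir A B i) := by
    intro i
    simp only [add_dotProduct, smul_dotProduct, smul_eq_mul]
    ring
  have hmem : (1 - α) • cin + α • cout ∈ C :=
    hC hin hout (by linarith) hα0 (by ring)
  refine edgeDir_mem_relevantSubspace hbdd hnd hmem
    ⟨hB.1, basicSolution_mem_optimalSet hB.1 hB.2.1 fun i hi => ?_⟩ ?_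
  · have hai := hcone i hi
    rw [key]
    -- A facet violated by `cout` is not crossed before `α`, by minimality. For any other facet both
    -- endpoints have nonnegative reduced cost.
    by_cases hoi : cout ⬝ᵥ edgeDir A B i < 0
    · have hden : 0 < cin ⬝ᵥ edgeDir A B i - cout ⬝ᵥ edgeDir A B i := by linarith
      have := (le_div_iff₀ hden).1 (hmin i hi hoi)
      linarith
    · nlinarith
  · rw [key, hα, hitRatio, div_mul_cancel₀ _ (by linarith), sub_self]

theorem dotProduct_eq_of_mem_span {D : Set (Fin d → ℝ)} {c c' : Fin d → ℝ}
    (h : ∀ q ∈ D, q ⬝ᵥ c = q ⬝ᵥ c') {v : Fin d → ℝ} (hv : v ∈ Submodule.span ℝ D) :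
    v ⬝ᵥ c = v ⬝ᵥ c' := by
  induction hv using Submodule.span_induction with
  | mem q hq => exact h q hq
  | zero => simp
  | add x y _ _ hx hy => rw [add_dotProduct, add_dotProduct, hx, hy]
  | smul a x _ hx => rw [smul_dotProduct, smul_dotProduct, hx]

variable {n : ℕ} {σ : ChoiceRule m d} {A : Matrix (Fin m) (Fin d) ℝ} {b : Fin m → ℝ}
  {C : Set (Fin d → ℝ)}

/-! ### The algorithm at one cost -/

theorem fiber_anti (C : Set (Fin d → ℝ)) {D D' : Finset (Fin d → ℝ)} (h : D ⊆ D')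
    (c : Fin d → ℝ) : fiber C D' c ⊆ fiber C D c :=
  fun _ hc => ⟨hc.1, fun q hq => hc.2 q (h hq)⟩

theorem PointwiseSufficient.mono {X : Set (Fin d → ℝ)} {D D' : Finset (Fin d → ℝ)} (h : D ⊆ D')
    {c : Fin d → ℝ} (hs : PointwiseSufficient X C D c) : PointwiseSufficient X C D' c := by
  obtain ⟨x, hx, hopt⟩ := hs
  exact ⟨x, hx, fun c' hc' => hopt c' (fiber_anti C h c hc')⟩

theorem ChoiceRule.nextQuery_eq_none {D : Finset (Fin d → ℝ)} {c : Fin d → ℝ} :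
    σ.nextQuery A C D c = none ↔ fiber C D c ⊆ basisCone A (σ.basis D c) := by
  unfold ChoiceRule.nextQuery
  split_ifs with h <;> simp [h]

theorem ChoiceRule.nextQuery_eq_some {D : Finset (Fin d → ℝ)} {c q : Fin d → ℝ} :
    σ.nextQuery A C D c = some q ↔ ¬ fiber C D c ⊆ basisCone A (σ.basis D c) ∧
      edgeDir A (σ.basis D c) (σ.facet D c) = q := by
  unfold ChoiceRule.nextQuery
  split_ifs with h <;> simp [h]

/-- Anchor and outer point lie in one fiber, so they agree on the span of `D`; the query is
nonnegative on the first and negative on the second. -/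
theorem ChoiceRule.Valid.query_notMem_span (hnd : Nondegenerate A b) (hσ : σ.Valid A b C)
    {D : Finset (Fin d → ℝ)} {c q : Fin d → ℝ} (hc : c ∈ C)
    (hq : σ.nextQuery A C D c = some q) : q ∉ Submodule.span ℝ (D : Set (Fin d → ℝ)) := by
  obtain ⟨hnot, rfl⟩ := ChoiceRule.nextQuery_eq_some.1 hq
  obtain ⟨hanchor, hbasis, hrest⟩ := hσ D c hc
  obtain ⟨houter, hfacet⟩ := hrest hnot
  intro hmem
  have heq := dotProduct_eq_of_mem_span
    (fun q hq => (hanchor.2 q hq).trans (houter.1.2 q hq).symm) hmem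
  have h1 := hbasis.mem_basisCone hnd _ hfacet.1
  have h2 := hfacet.2.1
  rw [dotProduct_comm, dotProduct_comm _ (σ.outer D c)] at heq
  linarith

theorem ChoiceRule.Valid.query_mem_relevantSubspace (hbdd : Bornology.IsBounded (polytope A b))
    (hnd : Nondegenerate A b) (hC : Convex ℝ C) (hσ : σ.Valid A b C)
    {D : Finset (Fin d → ℝ)} {c q : Fin d → ℝ} (hc : c ∈ C)
    (hq : σ.nextQuery A C D c = some q) : q ∈ relevantSubspace (polytope A b) C := by
  obtain ⟨hnot, rfl⟩ := ChoiceRule.nextQuery_eq_some.1 hq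
  obtain ⟨hanchor, hbasis, hrest⟩ := hσ D c hc
  obtain ⟨houter, hfacet⟩ := hrest hnot
  exact hfacet.edgeDir_mem hbdd hnd hC hanchor.1 houter.1.1 hbasis

namespace PointwiseRun

variable {c : Fin d → ℝ} {D D' : Finset (Fin d → ℝ)}

theorem unique (h : PointwiseRun σ A C c D D') {D'' : Finset (Fin d → ℝ)}
    (h' : PointwiseRun σ A C c D D'') : D' = D'' := by
  induction h with
  | contained D h =>
    cases h' with
    | contained _ _ => rfl
    | query _ _ q hq _ => simp [h] at hq
  | query D D' q hq _ ih =>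
    cases h' with
    | contained _ h => simp [h] at hq
    | query _ _ q' hq' hrun =>
      obtain rfl : q = q' := Option.some.inj (hq.symm.trans hq')
      exact ih hrun

theorem subset (h : PointwiseRun σ A C c D D') : D ⊆ D' := by
  classical
  induction h with
  | contained D _ => exact subset_rfl
  | query D D' q _ _ ih => exact (Finset.subset_insert q D).trans (by convert ih)

theorem nextQuery_eq_none (h : PointwiseRun σ A C c D D') : σ.nextQuery A C D' c = none := by
  induction h with
  | contained D h => exact h
  | query D D' q _ _ ih => exact ih

theorem pointwiseSufficient (hσ : σ.Valid A b C) (hc : c ∈ C)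
    (h : PointwiseRun σ A C c D D') : PointwiseSufficient (polytope A b) C D' c := by
  have hcone := ChoiceRule.nextQuery_eq_none.1 h.nextQuery_eq_none
  obtain ⟨-, hbasis, -⟩ := hσ D' c hc
  exact ⟨_, hbasis.2.1, fun c' hc' =>
    basicSolution_mem_optimalSet hbasis.1 hbasis.2.1 (hcone hc')⟩

theorem span_le (hbdd : Bornology.IsBounded (polytope A b)) (hnd : Nondegenerate A b)
    (hC : Convex ℝ C) (hσ : σ.Valid A b C) (hc : c ∈ C) (h : PointwiseRun σ A C c D D')
    (hD : Submodule.span ℝ (D : Set (Fin d → ℝ)) ≤ relevantSubspace (polytope A b) C) :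
    Submodule.span ℝ (D' : Set (Fin d → ℝ)) ≤ relevantSubspace (polytope A b) C := by
  induction h with
  | contained D _ => exact hD
  | query D D' q hq _ ih =>
    refine ih ?_
    rw [Finset.coe_insert, Submodule.span_insert, sup_le_iff, Submodule.span_singleton_le_iff_mem]
    exact ⟨hσ.query_mem_relevantSubspace hbdd hnd hC hc hq, hD⟩

theorem span_lt (hnd : Nondegenerate A b) (hσ : σ.Valid A b C) (hc : c ∈ C)
    (h : PointwiseRun σ A C c D D') (hne : D' ≠ D) :
    Submodule.span ℝ (D : Set (Fin d → ℝ)) < Submodule.span ℝ (D' : Set (Fin d → ℝ)) := by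
  cases h with
  | contained _ _ => exact absurd rfl hne
  | query _ _ q hq hrun =>
    have hsub := hrun.subset
    refine lt_of_le_of_ne (Submodule.span_mono fun x hx =>
      hsub (Finset.mem_insert_of_mem hx)) fun heq => hσ.query_notMem_span hnd hc hq ?_
    rw [heq]
    exact Submodule.subset_span (hsub (Finset.mem_insert_self _ _))

end PointwiseRun

/-- The algorithm terminates at every cost in `C`, from any dataset. -/
theorem exists_pointwiseRun (hnd : Nondegenerate A b) (hσ : σ.Valid A b C) {c : Fin d → ℝ}
    (hc : c ∈ C) (D : Finset (Fin d → ℝ)) : ∃ D', PointwiseRun σ A C c D D' := by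
  classical
  suffices H : ∀ (V : Submodule ℝ (Fin d → ℝ)) (D : Finset (Fin d → ℝ)),
      Submodule.span ℝ (D : Set (Fin d → ℝ)) = V → ∃ D', PointwiseRun σ A C c D D' from
    H _ D rfl
  intro V
  -- Strictly increasing chains of subspaces are finite in finite dimension, so the span serves as
  -- the termination measure.
  induction V using WellFoundedGT.induction with
  | ind V ih =>
    rintro D rfl
    cases hq : σ.nextQuery A C D c with
    | none => exact ⟨D, .contained D hq⟩
    | some q =>
      have hlt : Submodule.span ℝ (D : Set (Fin d → ℝ)) <
          Submodule.span ℝ ((insert q D : Finset (Fin d → ℝ)) : Set (Fin d → ℝ)) := by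
        refine lt_of_le_of_ne (Submodule.span_mono (by simp)) fun heq =>
          hσ.query_notMem_span hnd hc hq ?_
        rw [heq]
        exact Submodule.subset_span (by simp)
      obtain ⟨D', hD'⟩ := ih _ hlt _ rfl
      exact ⟨D', .query D D' q hq (by convert hD')⟩

/-! ### The cumulative algorithm -/

namespace CumulativeFrom

variable {S : Fin n → Fin d → ℝ} {D D' : Finset (Fin d → ℝ)} {l : List (Fin n)}
  {T : Finset (Fin n)}

theorem unique (h : CumulativeFrom σ A C S D l D' T) {D'' : Finset (Fin d → ℝ)}
    {T' : Finset (Fin n)} (h' : CumulativeFrom σ A C S D l D'' T') : D'' = D' ∧ T' = T := by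
  induction h generalizing T' with
  | nil D =>
    cases h'
    exact ⟨rfl, rfl⟩
  | easy D D' i l T h _ ih =>
    cases h' with
    | easy _ _ _ _ _ _ hrest => exact ih hrest
    | hard _ _ _ _ _ _ h₁ hne _ => exact absurd (h₁.unique h) hne
  | hard D D₁ D' i l T h hne _ ih =>
    cases h' with
    | easy _ _ _ _ _ h₁ _ => exact absurd (h.unique h₁) hne
    | hard _ D₂ _ _ _ _ h₁ _ hrest =>
      obtain rfl := h.unique h₁
      obtain ⟨rfl, rfl⟩ := ih hrest
      exact ⟨rfl, rfl⟩

theorem subset (h : CumulativeFrom σ A C S D l D' T) : D ⊆ D' := by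
  induction h with
  | nil D => exact subset_rfl
  | easy D D' i l T _ _ ih => exact ih
  | hard D D₁ D' i l T h _ _ ih => exact h.subset.trans ih

theorem pointwiseSufficient (hσ : σ.Valid A b C) (hS : ∀ i, S i ∈ C)
    (h : CumulativeFrom σ A C S D l D' T) :
    ∀ i ∈ l, PointwiseSufficient (polytope A b) C D' (S i) := by
  induction h with
  | nil D => simp
  | easy D D' i l T h hrest ih =>
    exact List.forall_mem_cons.2
      ⟨(h.pointwiseSufficient hσ (hS i)).mono hrest.subset, ih⟩
  | hard D D₁ D' i l T h _ hrest ih =>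
    exact List.forall_mem_cons.2
      ⟨(h.pointwiseSufficient hσ (hS i)).mono hrest.subset, ih⟩

/-- Dropping easy indices does not change the output. -/
theorem filter (h : CumulativeFrom σ A C S D l D' T) {J : Finset (Fin n)} (hJ : T ⊆ J) :
    CumulativeFrom σ A C S D (l.filter (fun i => i ∈ J)) D' T := by
  induction h with
  | nil D => exact .nil D
  | easy D D' i l T h _ ih =>
    rw [List.filter_cons]
    split_ifs
    · exact .easy _ _ _ _ _ h (ih hJ)
    · exact ih hJ
  | hard D D₁ D' i l T h hne _ ih =>
    rw [List.filter_cons_of_pos (by simpa using hJ (Finset.mem_insert_self i T))]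
    exact .hard _ _ _ _ _ _ h hne (ih ((Finset.subset_insert i T).trans hJ))

/-- The rank of the span is a potential: it grows by at least one at each hard index and never
exceeds the dimension of the relevant subspace. -/
theorem card_add_finrank_le (hbdd : Bornology.IsBounded (polytope A b))
    (hnd : Nondegenerate A b) (hC : Convex ℝ C) (hσ : σ.Valid A b C) (hS : ∀ i, S i ∈ C)
    (h : CumulativeFrom σ A C S D l D' T)
    (hD : Submodule.span ℝ (D : Set (Fin d → ℝ)) ≤ relevantSubspace (polytope A b) C) :
    T.card + Module.finrank ℝ (Submodule.span ℝ (D : Set (Fin d → ℝ))) ≤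
      intrinsicDim (polytope A b) C := by
  induction h with
  | nil D => simpa [intrinsicDim] using Submodule.finrank_mono hD
  | easy D D' i l T _ _ ih => exact ih hD
  | hard D D₁ D' i l T h hne _ ih =>
    have h1 := ih (h.span_le hbdd hnd hC hσ (hS i) hD)
    have h2 := Submodule.finrank_lt_finrank_of_lt (h.span_lt hnd hσ (hS i) hne)
    have h3 := Finset.card_insert_le i T
    omega

/-- A run reads only the listed costs; this locality makes its outcome independent of the remaining
sample points. -/
theorem congr {S' : Fin n → Fin d → ℝ} (h : CumulativeFrom σ A C S D l D' T)
    (hS : ∀ i ∈ l, S i = S' i) : CumulativeFrom σ A C S' D l D' T := by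
  induction h with
  | nil D => exact .nil D
  | easy D D' i l T h _ ih =>
    rw [List.forall_mem_cons] at hS
    exact .easy _ _ _ _ _ (hS.1 ▸ h) (ih hS.2)
  | hard D D₁ D' i l T h hne _ ih =>
    rw [List.forall_mem_cons] at hS
    exact .hard _ _ _ _ _ _ (hS.1 ▸ h) hne (ih hS.2)

end CumulativeFrom

theorem exists_cumulativeFrom (hnd : Nondegenerate A b) (hσ : σ.Valid A b C)
    {S : Fin n → Fin d → ℝ} (hS : ∀ i, S i ∈ C) (l : List (Fin n)) (D : Finset (Fin d → ℝ)) :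
    ∃ D' T, CumulativeFrom σ A C S D l D' T := by
  induction l generalizing D with
  | nil => exact ⟨D, ∅, .nil D⟩
  | cons i l ih =>
    obtain ⟨D₁, h₁⟩ := exists_pointwiseRun hnd hσ (hS i) D
    obtain ⟨D', T, h⟩ := ih D₁
    by_cases hne : D₁ = D
    · subst hne
      exact ⟨D', T, .easy _ _ _ _ _ h₁ h⟩
    · exact ⟨D', insert i T, .hard _ _ _ _ _ _ h₁ hne h⟩

/-- The cumulative algorithm is a realizable stable compression scheme. -/
theorem exists_cumulativeOutput (hbdd : Bornology.IsBounded (polytope A b))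
    (hnd : Nondegenerate A b) (hC : Convex ℝ C) (hσ : σ.Valid A b C)
    {S : Fin n → Fin d → ℝ} (hS : ∀ i, S i ∈ C) :
    ∃ (D : Finset (Fin d → ℝ)) (T : Finset (Fin n)),
      CumulativeOutput σ A C S Finset.univ D T ∧
      (∀ D' T', CumulativeOutput σ A C S Finset.univ D' T' → D' = D ∧ T' = T) ∧
      (∀ i, PointwiseSufficient (polytope A b) C D (S i)) ∧
      (∀ J : Finset (Fin n), T ⊆ J → CumulativeOutput σ A C S J D T) ∧
      T.card ≤ intrinsicDim (polytope A b) C := by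
  have huniv : (List.finRange n).filter (fun i => i ∈ (Finset.univ : Finset (Fin n))) =
      List.finRange n := by simp
  obtain ⟨D, T, h⟩ := exists_cumulativeFrom hnd hσ hS (List.finRange n) ∅
  refine ⟨D, T, ?_, fun D' T' h' => ?_, fun i => ?_, fun J hJ => h.filter hJ, ?_⟩
  · rw [CumulativeOutput, huniv]
    exact h
  · rw [CumulativeOutput, huniv] at h'
    exact h.unique h'
  · exact h.pointwiseSufficient hσ hS i (List.mem_finRange i)
  · exact le_of_add_le_left (h.card_add_finrank_le hbdd hnd hC hσ hS (by simp))

/-! ### Stable compression schemes -/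

section Compression

variable {X : Type*} [MeasurableSpace X] (P : Measure X) [IsProbabilityMeasure P]

/-- An event that depends only on the coordinates in `J` is independent of the others. -/
theorem measureReal_inter_forall_notMem (J : Finset (Fin n)) {E : Set (Fin n → X)}
    (hE : ∀ S S', (∀ i ∈ J, S i = S' i) → S ∈ E → S' ∈ E) (G : Set X) :
    (Measure.pi fun _ : Fin n => P).real (E ∩ {S | ∀ i ∉ J, S i ∈ G}) =
      (Measure.pi fun _ : Fin n => P).real E * P.real G ^ (n - J.card) := by
  classical
  have hmp := measurePreserving_piEquivPiSubtypeProd (fun _ : Fin n => P) (· ∈ J)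
  set e := MeasurableEquiv.piEquivPiSubtypeProd (fun _ : Fin n => X) (· ∈ J) with he
  -- `E` is the cylinder over its projection `F`. Neither `F` nor `G` need be measurable: the
  -- measurable equivalence and the product formulas for rectangles handle arbitrary sets.
  set F : Set ((i : {i // i ∈ J}) → X) := (fun S i => S i) '' E with hF
  have hFE : ∀ S : Fin n → X, (fun i : {i // i ∈ J} => S i) ∈ F ↔ S ∈ E := by
    refine fun S => ⟨?_, fun h => ⟨S, h, rfl⟩⟩
    rintro ⟨S', hS', heq⟩
    exact hE S' S (fun i hi => congrFun heq ⟨i, hi⟩) hS'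
  have h1 : E ∩ {S | ∀ i ∉ J, S i ∈ G} = e ⁻¹' (F ×ˢ Set.univ.pi fun _ => G) := by
    ext S
    simp only [Set.mem_inter_iff, Set.mem_preimage, Set.mem_prod, Set.mem_univ_pi]
    refine and_congr (hFE S).symm ⟨fun h i => h i i.2, fun h i hi => h ⟨i, hi⟩⟩
  have h2 : E = e ⁻¹' (F ×ˢ Set.univ) := by
    ext S
    simp only [Set.mem_preimage, Set.mem_prod, Set.mem_univ, and_true]
    exact (hFE S).symm
  have hcard : Fintype.card {i // i ∉ J} = n - J.card := by
    simp [Fintype.card_subtype_compl]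
  rw [h1, measureReal_def, hmp.measure_preimage_equiv, Measure.prod_prod, Measure.pi_pi]
  conv_rhs => rw [h2, measureReal_def, hmp.measure_preimage_equiv, Measure.prod_prod]
  rw [ENNReal.toReal_mul, ENNReal.toReal_mul, Finset.prod_const, Finset.card_univ, hcard,
    ENNReal.toReal_pow, measure_univ, ENNReal.toReal_one, mul_one, measureReal_def]

/-- Tail bound for a stable compression scheme. `E J D T` is the event that the run on the
subsample `J` returns `D` and the compression set `T`, and `G D` is the set of points where `D`
makes no error. -/
theorem measureReal_stable_compression_le {α : Type*} (𝒟 : Finset α)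
    {E : Finset (Fin n) → α → Finset (Fin n) → Set (Fin n → X)} (G : α → Set X)
    (hmeas : ∀ J D T, NullMeasurableSet (E J D T) (Measure.pi fun _ : Fin n => P))
    (hdep : ∀ J D T S S', (∀ i ∈ J, S i = S' i) → S ∈ E J D T → S' ∈ E J D T)
    (huniq : ∀ J D T D' T' S, S ∈ E J D T → S ∈ E J D' T' → D = D' ∧ T = T')
    (hfin : ∀ J D T S, S ∈ E J D T → D ∈ 𝒟)
    (Ω : Set (Fin n → X))
    (hstable : ∀ S ∈ Ω, ∀ D T, S ∈ E Finset.univ D T →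
      (∀ i, S i ∈ G D) ∧ ∀ J, T ⊆ J → S ∈ E J D T)
    (k : ℕ) {ε : ℝ} (hε : ε ≤ 1) :
    (Measure.pi fun _ : Fin n => P).real
        {S | S ∈ Ω ∧ ∃ D T, S ∈ E Finset.univ D T ∧ T.card = k ∧ P.real (G D) ≤ 1 - ε} ≤
      2 ^ k * (1 - ε / 2) ^ n := by
  classical
  set μ := Measure.pi fun _ : Fin n => P with hμ
  set O : Finset (α × Finset (Fin n)) :=
    (𝒟 ×ˢ Finset.univ).filter fun p => p.2.card = k ∧ P.real (G p.1) ≤ 1 - ε with hO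
  have hcover : {S | S ∈ Ω ∧ ∃ D T, S ∈ E Finset.univ D T ∧ T.card = k ∧ P.real (G D) ≤ 1 - ε} ⊆
      ⋃ p ∈ O, (Ω ∩ E Finset.univ p.1 p.2) := by
    rintro S ⟨hΩ, D, T, hS, hk, hG⟩
    refine Set.mem_biUnion (x := (D, T)) ?_ ⟨hΩ, hS⟩
    simp [hO, hk, hG, hfin _ _ _ _ hS]
  have hsum : ∀ J, ∑ p ∈ O, μ.real (E J p.1 p.2) ≤ 1 := by
    intro J
    rw [← measureReal_biUnion_finset₀ _ fun p _ => hmeas J p.1 p.2]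
    · exact measureReal_le_one
    · intro p _ q _ hpq
      refine Disjoint.aedisjoint (Set.disjoint_left.2 fun S hp hq => hpq ?_)
      obtain ⟨h1, h2⟩ := huniq _ _ _ _ _ _ hp hq
      exact Prod.ext h1 h2
  have hbound : ∀ p ∈ O, ∀ J, p.2 ⊆ J →
      μ.real (Ω ∩ E Finset.univ p.1 p.2) ≤ μ.real (E J p.1 p.2) * (1 - ε) ^ (n - J.card) := by
    intro p hp J hJ
    have hG := (Finset.mem_filter.1 hp).2.2
    calc μ.real (Ω ∩ E Finset.univ p.1 p.2)
        ≤ μ.real (E J p.1 p.2 ∩ {S | ∀ i ∉ J, S i ∈ G p.1}) := by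
          refine measureReal_mono ?_
          rintro S ⟨hΩ, hS⟩
          obtain ⟨h1, h2⟩ := hstable S hΩ _ _ hS
          exact ⟨h2 J hJ, fun i _ => h1 i⟩
      _ = μ.real (E J p.1 p.2) * P.real (G p.1) ^ (n - J.card) :=
          measureReal_inter_forall_notMem P J (hdep J p.1 p.2) _
      _ ≤ _ := by gcongr
  -- Using all 2^(n - k) supersets of the compression set, not just the set itself, replaces a union
  -- bound over the choice of that set by the single factor 2^k.
  have hmul : ∀ p ∈ O, 2 ^ n * μ.real (Ω ∩ E Finset.univ p.1 p.2) ≤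
      2 ^ k * ∑ J, μ.real (E J p.1 p.2) * (1 - ε) ^ (n - J.card) := by
    intro p hp
    have hk : p.2.card = k := (Finset.mem_filter.1 hp).2.1
    have hkn : k ≤ n := hk ▸ (Finset.card_le_univ p.2).trans_eq (Fintype.card_fin n)
    have hcard : (Finset.Icc p.2 Finset.univ).card = 2 ^ (n - k) := by
      rw [Finset.card_Icc_finset (Finset.subset_univ _), hk, Finset.card_univ, Fintype.card_fin]
    have h1 : 2 ^ (n - k) * μ.real (Ω ∩ E Finset.univ p.1 p.2) ≤
        ∑ J, μ.real (E J p.1 p.2) * (1 - ε) ^ (n - J.card) := by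
      calc 2 ^ (n - k) * μ.real (Ω ∩ E Finset.univ p.1 p.2)
          = ∑ J ∈ Finset.Icc p.2 Finset.univ, μ.real (Ω ∩ E Finset.univ p.1 p.2) := by
            rw [Finset.sum_const, hcard, nsmul_eq_mul]
            norm_cast
        _ ≤ ∑ J ∈ Finset.Icc p.2 Finset.univ, μ.real (E J p.1 p.2) * (1 - ε) ^ (n - J.card) :=
            Finset.sum_le_sum fun J hJ => hbound p hp J (Finset.mem_Icc.1 hJ).1
        -- Enlarging the range to all `J` removes its dependence on `p`, so that the sums over `p`
        -- and `J` can be exchanged.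
        _ ≤ _ := Finset.sum_le_sum_of_subset_of_nonneg (Finset.subset_univ _) fun J _ _ =>
            mul_nonneg measureReal_nonneg (pow_nonneg (by linarith) _)
    calc 2 ^ n * μ.real (Ω ∩ E Finset.univ p.1 p.2)
        = 2 ^ k * (2 ^ (n - k) * μ.real (Ω ∩ E Finset.univ p.1 p.2)) := by
          rw [← mul_assoc, ← pow_add, Nat.add_sub_cancel' hkn]
      _ ≤ _ := by gcongr
  have htotal : 2 ^ n * ∑ p ∈ O, μ.real (Ω ∩ E Finset.univ p.1 p.2) ≤ 2 ^ k * (2 - ε) ^ n := by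
    calc 2 ^ n * ∑ p ∈ O, μ.real (Ω ∩ E Finset.univ p.1 p.2)
        ≤ ∑ p ∈ O, 2 ^ k * ∑ J, μ.real (E J p.1 p.2) * (1 - ε) ^ (n - J.card) := by
          rw [Finset.mul_sum]
          exact Finset.sum_le_sum hmul
      _ = 2 ^ k * ∑ J : Finset (Fin n),
            (∑ p ∈ O, μ.real (E J p.1 p.2)) * (1 - ε) ^ (n - J.card) := by
          rw [← Finset.mul_sum, Finset.sum_comm]
          simp_rw [Finset.sum_mul]
      _ ≤ 2 ^ k * ∑ J : Finset (Fin n), 1 ^ J.card * (1 - ε) ^ (n - J.card) := by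
          refine mul_le_mul_of_nonneg_left (Finset.sum_le_sum fun J _ => ?_) (by positivity)
          rw [one_pow]
          exact mul_le_mul_of_nonneg_right (hsum J) (pow_nonneg (by linarith) _)
      _ = 2 ^ k * (2 - ε) ^ n := by
          rw [Fin.sum_pow_mul_eq_add_pow]
          ring
  have hhalf : (2 - ε) ^ n = 2 ^ n * (1 - ε / 2) ^ n := by
    rw [← mul_pow]
    ring
  calc μ.real _ ≤ μ.real (⋃ p ∈ O, (Ω ∩ E Finset.univ p.1 p.2)) := measureReal_mono hcover (measure_ne_top _ _)
    _ ≤ ∑ p ∈ O, μ.real (Ω ∩ E Finset.univ p.1 p.2) := measureReal_biUnion_finset_le _ _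
    _ ≤ 2 ^ k * (1 - ε / 2) ^ n := by
      rw [hhalf, mul_left_comm] at htotal
      exact le_of_mul_le_mul_left htotal (by positivity)

/-- The tail bound at the level used by the certificate. -/
theorem two_pow_mul_one_sub_half_pow_le (hn : 0 < n) {δ : ℝ} (hδ : 0 < δ) (hδ1 : δ < 1) (k : ℕ)
    (hε : 4 / (n : ℝ) * (6 * (k : ℝ) + Real.log (Real.exp 1 / δ)) ≤ 1) :
    2 ^ k * (1 - 4 / (n : ℝ) * (6 * (k : ℝ) + Real.log (Real.exp 1 / δ)) / 2) ^ n ≤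
      δ * (1 / 2) ^ (k + 1) := by
  have hn' : (0 : ℝ) < n := Nat.cast_pos.2 hn
  set L := Real.log (Real.exp 1 / δ) with hL
  set ε := 4 / (n : ℝ) * (6 * (k : ℝ) + L) with hεdef
  have hexpL : Real.exp (-L) = δ / Real.exp 1 := by
    rw [Real.exp_neg, hL, Real.exp_log (by positivity), inv_div]
  have hnε : n * (-(ε / 2)) = k * (-12) + 2 * (-L) := by
    rw [hεdef]
    field_simp
    ring
  have hpow : (1 - ε / 2) ^ n ≤ Real.exp (-12) ^ k * (δ / Real.exp 1) ^ 2 := by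
    calc (1 - ε / 2) ^ n ≤ Real.exp (-(ε / 2)) ^ n :=
          pow_le_pow_left₀ (by linarith) (Real.one_sub_le_exp_neg _) n
      _ = Real.exp (-12) ^ k * (δ / Real.exp 1) ^ 2 := by
          rw [← Real.exp_nat_mul, hnε, Real.exp_add, Real.exp_nat_mul, ← hexpL, two_mul,
            Real.exp_add, sq]
  -- The value 1/4 is enough: it turns the factor 2^k into 2^(-k).
  have h12 : Real.exp (-12) ≤ 1 / 4 := by
    rw [Real.exp_neg, one_div]
    exact inv_anti₀ (by norm_num) (by linarith [Real.add_one_le_exp (12 : ℝ)])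
  -- One factor supplies `δ`, the other the extra 1/2 that makes the sum over `k` at most `δ`.
  have he : (δ / Real.exp 1) ^ 2 ≤ δ * (1 / 2) := by
    have h2 : (2 : ℝ) ≤ Real.exp 1 := by linarith [Real.add_one_le_exp (1 : ℝ)]
    have h3 : δ / Real.exp 1 ≤ 1 / 2 := by
      rw [div_le_div_iff₀ (by positivity) (by norm_num)]
      linarith
    have h4 : δ / Real.exp 1 ≤ δ := div_le_self hδ.le (by linarith)
    rw [sq]
    exact mul_le_mul h4 h3 (by positivity) hδ.le
  calc 2 ^ k * (1 - ε / 2) ^ n ≤ 2 ^ k * ((1 / 4) ^ k * (δ * (1 / 2))) := by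
        gcongr
        exact hpow.trans (mul_le_mul (pow_le_pow_left₀ (Real.exp_pos _).le h12 k) he
          (by positivity) (by positivity))
    _ = δ * (1 / 2) ^ (k + 1) := by
        rw [← mul_assoc, ← mul_pow, pow_succ]
        norm_num
        ring

end Compression

/-! ### Measurability of the runs -/

/-- All edge directions of all choices of columns. -/
noncomputable def edgeDirs (A : Matrix (Fin m) (Fin d) ℝ) : Finset (Fin d → ℝ) :=
  (Set.finite_range fun p : (Fin m ↪o Fin d) × Fin d => edgeDir A p.1 p.2).toFinset

theorem ChoiceRule.nextQuery_mem_edgeDirs {D : Finset (Fin d → ℝ)} {c q : Fin d → ℝ}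
    (hq : σ.nextQuery A C D c = some q) : q ∈ edgeDirs A := by
  obtain ⟨-, rfl⟩ := ChoiceRule.nextQuery_eq_some.1 hq
  simp [edgeDirs]

-- Only finitely many datasets can be reached from `D`, which keeps the unions over outcomes finite.
open Classical in
theorem PointwiseRun.subset_union {c : Fin d → ℝ} {D D' : Finset (Fin d → ℝ)}
    (h : PointwiseRun σ A C c D D') : D' ⊆ D ∪ edgeDirs A := by
  induction h with
  | contained D _ => exact Finset.subset_union_left
  | query D D' q hq _ ih =>
    refine ih.trans (Finset.union_subset ?_ Finset.subset_union_right)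
    exact Finset.insert_subset
      (Finset.mem_union_right _ (ChoiceRule.nextQuery_mem_edgeDirs hq)) Finset.subset_union_left

open Classical in
theorem CumulativeFrom.subset_union {S : Fin n → Fin d → ℝ} {D D' : Finset (Fin d → ℝ)}
    {l : List (Fin n)} {T : Finset (Fin n)} (h : CumulativeFrom σ A C S D l D' T) :
    D' ⊆ D ∪ edgeDirs A := by
  induction h with
  | nil D => exact Finset.subset_union_left
  | easy D D' i l T _ _ ih => exact ih
  | hard D D₁ D' i l T h _ _ ih =>
    exact ih.trans (Finset.union_subset h.subset_union Finset.subset_union_right)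

/-- A run that repeats a query does not terminate. -/
theorem PointwiseRun.query_notMem {c : Fin d → ℝ} {D D' : Finset (Fin d → ℝ)}
    (h : PointwiseRun σ A C c D D') {q : Fin d → ℝ} (hq : σ.nextQuery A C D c = some q) :
    q ∉ D := by
  induction h with
  | contained D h => simp [h] at hq
  | query D D' q' hq' _ ih =>
    obtain rfl : q = q' := Option.some.inj (hq.symm.trans hq')
    intro hmem
    -- Inserting a present query changes nothing, so the shorter run would face the same query from
    -- the same dataset.
    rw [Finset.insert_eq_of_mem hmem] at ih
    exact ih hq hmem

-- Unrolling one iteration writes the event as a finite union; since a terminating run never repeats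
-- a query, the number of unused edge directions drops and the induction closes.
open Classical in
theorem nullMeasurableSet_pointwiseRun {P : Measure (Fin d → ℝ)}
    (hstep : ∀ (D : Finset (Fin d → ℝ)) (q : Option (Fin d → ℝ)),
      NullMeasurableSet {c | σ.nextQuery A C D c = q} P) (D D' : Finset (Fin d → ℝ)) :
    NullMeasurableSet {c | PointwiseRun σ A C c D D'} P := by
  induction hN : (edgeDirs A \ D).card using Nat.strong_induction_on generalizing D with
  | _ N ih =>
    have heq : {c | PointwiseRun σ A C c D D'} =
        {c | σ.nextQuery A C D c = none ∧ D = D'} ∪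
        ⋃ q ∈ edgeDirs A \ D,
          {c | σ.nextQuery A C D c = some q} ∩ {c | PointwiseRun σ A C c (insert q D) D'} := by
      ext c
      simp only [Set.mem_union, Set.mem_iUnion, Set.mem_inter_iff, Set.mem_ofPred_eq, exists_prop,
        Finset.mem_sdiff]
      constructor
      · intro h
        cases hq : σ.nextQuery A C D c with
        | none =>
          refine Or.inl ⟨rfl, ?_⟩
          exact (PointwiseRun.contained D hq).unique h
        | some q =>
          refine Or.inr ⟨q, ⟨ChoiceRule.nextQuery_mem_edgeDirs hq, h.query_notMem hq⟩, rfl, ?_⟩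
          cases h with
          | contained _ h => simp [h] at hq
          | query _ _ q' hq' hrun =>
            obtain rfl : q = q' := Option.some.inj (hq.symm.trans hq')
            exact hrun
      · rintro (⟨hq, rfl⟩ | ⟨q, -, hq, hrun⟩)
        · exact .contained D hq
        · exact .query D D' q hq hrun
    rw [heq]
    refine NullMeasurableSet.union ?_ ?_
    · by_cases hD : D = D'
      · simpa [hD] using hstep D' none
      · simp [hD]
    · refine NullMeasurableSet.biUnion (Finset.countable_toSet _) fun q hq => ?_
      refine (hstep D (some q)).inter (ih _ ?_ (insert q D) rfl)
      rw [← hN]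
      refine Finset.card_lt_card (Finset.ssubset_iff_subset_ne.2 ⟨?_, fun h => ?_⟩)
      · exact Finset.sdiff_subset_sdiff subset_rfl (Finset.subset_insert q D)
      · have : q ∈ edgeDirs A \ insert q D := h ▸ hq
        simp at this

open Classical in
theorem nullMeasurableSet_cumulativeFrom {P : Measure (Fin d → ℝ)} [IsProbabilityMeasure P]
    (hstep : ∀ (D : Finset (Fin d → ℝ)) (q : Option (Fin d → ℝ)),
      NullMeasurableSet {c | σ.nextQuery A C D c = q} P)
    (l : List (Fin n)) (D D' : Finset (Fin d → ℝ)) (T : Finset (Fin n)) :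
    NullMeasurableSet {S : Fin n → Fin d → ℝ | CumulativeFrom σ A C S D l D' T}
      (Measure.pi fun _ : Fin n => P) := by
  have hrun : ∀ (i : Fin n) (D D' : Finset (Fin d → ℝ)),
      NullMeasurableSet {S : Fin n → Fin d → ℝ | PointwiseRun σ A C (S i) D D'}
        (Measure.pi fun _ : Fin n => P) := fun i D D' =>
    (nullMeasurableSet_pointwiseRun hstep D D').preimage
      (measurePreserving_eval (fun _ : Fin n => P) i).quasiMeasurePreserving
  induction l generalizing D T with
  | nil =>
    have heq : {S : Fin n → Fin d → ℝ | CumulativeFrom σ A C S D [] D' T} =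
        {S | D' = D ∧ T = ∅} := by
      ext S
      refine ⟨fun h => ?_, ?_⟩
      · cases h
        exact ⟨rfl, rfl⟩
      · rintro ⟨rfl, rfl⟩
        exact .nil D'
    rw [heq]
    exact MeasurableSet.nullMeasurableSet (MeasurableSet.const _)
  | cons i l ih =>
    have heq : {S : Fin n → Fin d → ℝ | CumulativeFrom σ A C S D (i :: l) D' T} =
        ({S | PointwiseRun σ A C (S i) D D} ∩ {S | CumulativeFrom σ A C S D l D' T}) ∪
        ⋃ p ∈ ((D ∪ edgeDirs A).powerset ×ˢ (Finset.univ : Finset (Finset (Fin n)))).filter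
            fun p => p.1 ≠ D ∧ insert i p.2 = T,
          {S | PointwiseRun σ A C (S i) D p.1} ∩ {S | CumulativeFrom σ A C S p.1 l D' p.2} := by
      ext S
      simp only [Set.mem_union, Set.mem_iUnion, Set.mem_inter_iff, Set.mem_ofPred_eq, exists_prop,
        Finset.mem_filter, Finset.mem_product, Finset.mem_powerset, Finset.mem_univ, and_true]
      constructor
      · intro h
        cases h with
        | easy _ _ _ _ _ h hrest => exact Or.inl ⟨h, hrest⟩
        | hard _ D₁ _ _ _ T₁ h hne hrest =>
          exact Or.inr ⟨(D₁, T₁), ⟨h.subset_union, hne, by congr⟩, h, hrest⟩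
      · rintro (⟨h, hrest⟩ | ⟨⟨D₁, T₁⟩, ⟨-, hne, rfl⟩, h, hrest⟩)
        · exact .easy _ _ _ _ _ h hrest
        · convert CumulativeFrom.hard _ _ _ _ _ _ h hne hrest
    rw [heq]
    refine ((hrun i D D).inter (ih D T)).union ?_
    exact NullMeasurableSet.biUnion (Finset.countable_toSet _) fun p _ =>
      (hrun i D p.1).inter (ih p.1 p.2)

theorem CumulativeOutput.congr {S S' : Fin n → Fin d → ℝ} {J : Finset (Fin n)}
    {D : Finset (Fin d → ℝ)} {T : Finset (Fin n)} (h : CumulativeOutput σ A C S J D T)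
    (hS : ∀ i ∈ J, S i = S' i) : CumulativeOutput σ A C S' J D T :=
  CumulativeFrom.congr h fun i hi => hS i (by simpa using hi)

theorem measureReal_pointwiseSufficient (P : Measure (Fin d → ℝ)) [IsProbabilityMeasure P]
    {X : Set (Fin d → ℝ)} {D : Finset (Fin d → ℝ)}
    (hloss : NullMeasurableSet {c | ¬ PointwiseSufficient X C D c} P) :
    P.real {c | PointwiseSufficient X C D c} = 1 - risk X C P D := by
  have h := probReal_compl_eq_one_sub₀ hloss
  rw [risk, ← h]
  congr 1
  ext c
  simp

/-- The certificate: with probability at least `1 - δ` the risk obeys the compression bound. -/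
theorem measure_certificate_le (hn : 0 < n) (hbdd : Bornology.IsBounded (polytope A b))
    (hnd : Nondegenerate A b) (hC : Convex ℝ C)
    (P : Measure (Fin d → ℝ)) [IsProbabilityMeasure P] (hP : ∀ᵐ c ∂P, c ∈ C)
    (hσ : σ.Valid A b C)
    (hloss : ∀ D : Finset (Fin d → ℝ),
      NullMeasurableSet {c | ¬ PointwiseSufficient (polytope A b) C D c} P)
    (hstep : ∀ (D : Finset (Fin d → ℝ)) (q : Option (Fin d → ℝ)),
      NullMeasurableSet {c | σ.nextQuery A C D c = q} P)
    {δ : ℝ} (hδ : 0 < δ) (hδ1 : δ < 1) :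
    Measure.pi (fun _ : Fin n => P)
        {S | ¬ ∃ (D : Finset (Fin d → ℝ)) (T : Finset (Fin n)),
          CumulativeOutput σ A C S Finset.univ D T ∧
          risk (polytope A b) C P D
            ≤ 4 / (n : ℝ) * (6 * (T.card : ℝ) + Real.log (Real.exp 1 / δ)) ∧
          4 / (n : ℝ) * (6 * (T.card : ℝ) + Real.log (Real.exp 1 / δ))
            ≤ 4 / (n : ℝ) *
              (6 * (intrinsicDim (polytope A b) C : ℝ) + Real.log (Real.exp 1 / δ))}
      ≤ ENNReal.ofReal δ := by
  classical
  set μ := Measure.pi fun _ : Fin n => P with hμ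
  set K := intrinsicDim (polytope A b) C with hK
  set ε : ℕ → ℝ := fun k => 4 / (n : ℝ) * (6 * (k : ℝ) + Real.log (Real.exp 1 / δ)) with hε
  set Ω : Set (Fin n → Fin d → ℝ) := {S | ∀ i, S i ∈ C} with hΩ
  set E : Finset (Fin n) → Finset (Fin d → ℝ) → Finset (Fin n) → Set (Fin n → Fin d → ℝ) :=
    fun J D T => {S | CumulativeOutput σ A C S J D T} with hE
  set G : Finset (Fin d → ℝ) → Set (Fin d → ℝ) :=
    fun D => {c | PointwiseSufficient (polytope A b) C D c} with hG
  set bad : ℕ → Set (Fin n → Fin d → ℝ) := fun k =>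
    {S | S ∈ Ω ∧ ∃ D T, S ∈ E Finset.univ D T ∧ T.card = k ∧ ε k < risk (polytope A b) C P D}
    with hbad
  have hΩae : ∀ᵐ S ∂μ, S ∈ Ω := by
    refine ae_all_iff.2 fun i => ?_
    exact (measurePreserving_eval (fun _ : Fin n => P) i).quasiMeasurePreserving.ae hP
  have hbound : ∀ k, μ.real (bad k) ≤ δ * (1 / 2) ^ (k + 1) := by
    intro k
    by_cases hk : ε k ≤ 1
    · refine le_trans (measureReal_mono ?_) ((measureReal_stable_compression_le P
        (E := E) (edgeDirs A).powerset G ?_ ?_ ?_ ?_ Ω ?_ k hk).trans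
          (two_pow_mul_one_sub_half_pow_le hn hδ hδ1 k hk))
      · rintro S ⟨hS, D, T, hout, hT, hrisk⟩
        refine ⟨hS, D, T, hout, hT, ?_⟩
        rw [hG, measureReal_pointwiseSufficient P (hloss D)]
        linarith
      · exact fun J D T => nullMeasurableSet_cumulativeFrom hstep _ _ _ _
      · exact fun J D T S S' hS h => CumulativeOutput.congr h hS
      · exact fun J D T D' T' S h h' => CumulativeFrom.unique h' h
      · intro J D T S h
        simpa using CumulativeFrom.subset_union h
      · intro S hS D T h
        obtain ⟨D', T', -, huniq, hsuff, hstable, -⟩ := exists_cumulativeOutput hbdd hnd hC hσ hS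
        obtain ⟨rfl, rfl⟩ := huniq D T h
        exact ⟨hsuff, hstable⟩
    -- The tail bound needs a level of at most 1; above it there is nothing to prove, as a risk
    -- never exceeds 1.
    · have hempty : bad k = ∅ := by
        refine Set.eq_empty_of_forall_notMem ?_
        rintro S ⟨-, D, T, -, -, hrisk⟩
        exact hk (hrisk.le.trans measureReal_le_one)
      rw [hempty, measureReal_empty]
      positivity
  -- Almost surely the sample lies in `C`, where a failure of the certificate is a bad event for
  -- some k ≤ d⋆. Only monotonicity is used, so the failure event itself need not be measurable.
  refine (measure_mono_ae (t := ⋃ k ∈ Finset.range (K + 1), bad k) ?_).trans ?_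
  · filter_upwards [hΩae] with S hS hnot
    obtain ⟨D, T, hout, -, -, -, hcard⟩ := exists_cumulativeOutput hbdd hnd hC hσ hS
    refine Set.mem_biUnion (x := T.card) (by simpa [Nat.lt_succ_iff] using hcard)
      ⟨hS, D, T, hout, rfl, lt_of_not_ge fun hle => hnot ⟨D, T, hout, hle, ?_⟩⟩
    gcongr
  · rw [← ENNReal.ofReal_toReal (measure_ne_top μ _)]
    refine ENNReal.ofReal_le_ofReal ?_
    calc μ.real (⋃ k ∈ Finset.range (K + 1), bad k)
        ≤ ∑ k ∈ Finset.range (K + 1), μ.real (bad k) := measureReal_biUnion_finset_le _ _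
      _ ≤ ∑ k ∈ Finset.range (K + 1), δ * (1 / 2) ^ (k + 1) :=
          Finset.sum_le_sum fun k _ => hbound k
      _ = δ * (1 / 2) * ∑ k ∈ Finset.range (K + 1), (1 / 2 : ℝ) ^ k := by
          rw [Finset.mul_sum]
          exact Finset.sum_congr rfl fun k _ => by ring
      _ ≤ δ * (1 / 2) * 2 := by
          gcongr
          exact sum_geometric_two_le _
      _ = δ := by ring

end DecisionData

theorem mainTheorem6 {m d n : ℕ} (hn : 0 < n)
    (A : Matrix (Fin m) (Fin d) ℝ) (b : Fin m → ℝ)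
    (hA : A.rank = m)
    (hXne : (DecisionData.polytope A b).Nonempty)
    (hXbdd : Bornology.IsBounded (DecisionData.polytope A b))
    (hXnd : DecisionData.Nondegenerate A b)
    (C : Set (Fin d → ℝ)) (hC : Convex ℝ C)
    (P : Measure (Fin d → ℝ)) [IsProbabilityMeasure P] (hP : ∀ᵐ c ∂P, c ∈ C)
    (σ : DecisionData.ChoiceRule m d) (hσ : σ.Valid A b C)
    -- measurability of the loss and of the steps of the algorithm
    (hloss : ∀ D : Finset (Fin d → ℝ), NullMeasurableSet
      {c | ¬ DecisionData.PointwiseSufficient (DecisionData.polytope A b) C D c} P)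
    (hstep : ∀ (D : Finset (Fin d → ℝ)) (q : Option (Fin d → ℝ)),
      NullMeasurableSet {c | σ.nextQuery A C D c = q} P) :
    -- the algorithm is a realizable stable compression scheme of size at most `d⋆`
    (∀ S : Fin n → Fin d → ℝ, (∀ i, S i ∈ C) →
      ∃ (D : Finset (Fin d → ℝ)) (T : Finset (Fin n)),
        DecisionData.CumulativeOutput σ A C S Finset.univ D T ∧
        (∀ D' T', DecisionData.CumulativeOutput σ A C S Finset.univ D' T' → D' = D ∧ T' = T) ∧
        (∀ i, DecisionData.PointwiseSufficient (DecisionData.polytope A b) C D (S i)) ∧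
        (∀ J : Finset (Fin n), T ⊆ J → DecisionData.CumulativeOutput σ A C S J D T) ∧
        T.card ≤ DecisionData.intrinsicDim (DecisionData.polytope A b) C) ∧
    -- the certificate: the exceptional event has (outer) probability at most `δ`
    (∀ δ : ℝ, 0 < δ → δ < 1 →
      Measure.pi (fun _ : Fin n => P)
        {S | ¬ ∃ (D : Finset (Fin d → ℝ)) (T : Finset (Fin n)),
          DecisionData.CumulativeOutput σ A C S Finset.univ D T ∧
          DecisionData.risk (DecisionData.polytope A b) C P D
            ≤ 4 / (n : ℝ) * (6 * (T.card : ℝ) + Real.log (Real.exp 1 / δ)) ∧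
          4 / (n : ℝ) * (6 * (T.card : ℝ) + Real.log (Real.exp 1 / δ))
            ≤ 4 / (n : ℝ) *
              (6 * (DecisionData.intrinsicDim (DecisionData.polytope A b) C : ℝ)
                + Real.log (Real.exp 1 / δ))}
        ≤ ENNReal.ofReal δ) := by
  refine ⟨fun S hS => DecisionData.exists_cumulativeOutput hXbdd hXnd hC hσ hS,
    fun δ hδ hδ1 => ?_⟩
  exact DecisionData.measure_certificate_le hn hXbdd hXnd hC P hP hσ hloss hstep hδ hδ1
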